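/- Let $K$ be a field of characteristic zero (for instance $\mathbb{R}$ or $\mathbb{C}$), let $m\ge 1$, and let $P(x)=c_0x^{2m}+c_1x^{2m-2}+\dots+c_m$ with $c_0,\dots,c_m\in K$, $c_0\neq 0$. Let $a_n\in K$, $n\ge -m+1$, with $a_{-m+1}=\dots=a_0=0$, and let $\mathbf J$ be the semi-infinite symmetric tridiagonal (Jacobi) matrix, with rows and columns indexed by $0,1,2,\dots$, with zero diagonal $b_0=b_1=\dots=0$ and with off-diagonal entries $\mathbf J_{n-1,n}=\mathbf J_{n,n-1}=a_n$, $n\ge1$. Freud's equations for $(a_n)$ are $$a_n\,(P'(\mathbf J))_{n,n-1}=n,\qquad n=1,2,\dots \tag{F}$$ (i) For every $\mu_0\in K\setminus\{0\}$ there is exactly one sequence $(\mu_j)_{j\ge0}$ in $K$ beginning with $\mu_0$ such that $\mu_{2j+1}=0$ for all $j\ge0$, $$2mc_0\,\mu_{2n+2m}+(2m-2)c_1\,\mu_{2n+2m-2}+\dots+2c_{m-1}\,\mu_{2n+2}=(2n+1)\,\mu_{2n},\qquad n=0,1,\dots,$$ and $\mu_{2j}/\mu_0=(\mathbf J^{2j})_{0,0}$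 for $j=1,\dots,m-1$. The numbers $(\mathbf J^{2j})_{0,0}$, $0\le j\le m-1$, depend only on the initial data $a_1,\dots,a_{m-1}$. (ii) Let $(\mu_j)$ be such a sequence, let $H_n=\det(\mu_{i+j})_{0\le i,j\le n-1}$ with $H_0=1$, and let $\tilde H_n$ be the determinant obtained from $H_n$ by replacing its last column by $(\mu_n,\dots,\mu_{2n-1})^{T}$, with $\tilde H_0=0$. Then $(a_n)$ satisfies Freud's equations (F) if and only if $H_n\ne0$ for all $n\ge0$ and $$a_n^2=\frac{H_{n-1}H_{n+1}}{H_n^2}\quad(n\ge1),\qquad 0=b_n=\frac{\tilde H_{n+1}}{H_{n+1}}-\frac{\tilde H_n}{H_n}\quad(n\ge0).$$ -/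

import Mathlib

noncomputable section

namespace Freud

open Polynomial

variable {K : Type*} [Field K]

/-- The semi-infinite Jacobi matrix, rows and columns indexed by `0, 1, 2, …`, with diagonal
`b 0, b 1, …` and off-diagonal entries `a 1, a 2, …`, as an endomorphism of the space of finitely
supported sequences: column `j` holds `a (j+1)` in row `j+1`, `b j` in row `j` and, if `j ≥ 1`,
`a j` in row `j-1`. Composition of such endomorphisms is the product of (column-finite) infinite
matrices. The values of `a` at nonpositive indices do not occur. -/
def jacobi (a : ℤ → K) (b : ℕ → K) : Module.End K (ℕ →₀ K) :=
  Finsupp.linearCombination K fun j : ℕ =>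
    Finsupp.single (j + 1) (a (j + 1)) + Finsupp.single j (b j) +
      (if 1 ≤ j then Finsupp.single (j - 1) (a j) else 0)

/-- The entry in row `i` and column `j` of the infinite matrix of `T`. -/
def entry (T : Module.End K (ℕ →₀ K)) (i j : ℕ) : K :=
  T (Finsupp.single j 1) i

/-- The polynomial `c 0 * X ^ (2m) + c 1 * X ^ (2m-2) + ⋯ + c m`. -/
def evenPoly (m : ℕ) (c : ℕ → K) : K[X] :=
  ∑ i ∈ Finset.range (m + 1), C (c i) * X ^ (2 * (m - i))

/-- `F_n(a) = a_n (P'(J))_{n,n-1}`, where `J` is the Jacobi matrix with zero diagonal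
(used for `n ≥ 1`). -/
def freudF (P : K[X]) (a : ℤ → K) (n : ℕ) : K :=
  a n * entry (aeval (jacobi a 0) (derivative P)) n (n - 1)

/-- Freud's equations `F_n(a) = n`, `n = 1, 2, …`. -/
def SolvesFreud (P : K[X]) (a : ℤ → K) : Prop :=
  ∀ n : ℕ, 1 ≤ n → freudF P a n = n

/-- The Hankel determinant `H_n` with entries `μ (i + j)`, `0 ≤ i, j ≤ n - 1`; `H_0 = 1`. -/
def hankelDet (μ : ℕ → K) (n : ℕ) : K :=
  (Matrix.of fun i j : Fin n => μ (i + j)).det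

/-- The determinant obtained from `H_n` by replacing the last column
`μ (n-1), …, μ (2n-2)` by `μ n, …, μ (2n-1)`, with value `0` at `n = 0`. -/
def hankelDetTilde (μ : ℕ → K) (n : ℕ) : K :=
  if n = 0 then 0 else
    (Matrix.of fun i j : Fin n => μ (i + if (j : ℕ) + 1 = n then n else (j : ℕ))).det

/-- The recurrence coefficients `a_n` (`n ≥ 1`) and `b_n` (`n ≥ 0`) are given by the
Hankel determinants of `μ`, none of which vanishes. -/
def GivenByHankel (μ : ℕ → K) (a : ℤ → K) (b : ℕ → K) : Prop :=
  (∀ n, hankelDet μ n ≠ 0) ∧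
  (∀ n : ℕ, 1 ≤ n →
    a n ^ 2 = hankelDet μ (n - 1) * hankelDet μ (n + 1) / hankelDet μ n ^ 2) ∧
  (∀ n : ℕ, b n = hankelDetTilde μ (n + 1) / hankelDet μ (n + 1) -
    hankelDetTilde μ n / hankelDet μ n)

/-- The odd moments vanish and, for `n = 0, 1, …`,
`2m c_0 μ_{2n+2m} + (2m-2) c_1 μ_{2n+2m-2} + ⋯ + 2 c_{m-1} μ_{2n+2} = (2n+1) μ_{2n}`. -/
def MomentRecurrence (m : ℕ) (c : ℕ → K) (μ : ℕ → K) : Prop :=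
  (∀ j, μ (2 * j + 1) = 0) ∧
  ∀ n : ℕ, ∑ i ∈ Finset.range m,
    ((2 * (m - i) : ℕ) : K) * c i * μ (2 * n + 2 * (m - i)) = (2 * n + 1 : K) * μ (2 * n)

/-- The initial moments: `μ_{2j} / μ_0 = (J^{2j})_{0,0}` for `j = 1, …, m - 1`. -/
def InitialMoments (m : ℕ) (a : ℤ → K) (μ : ℕ → K) : Prop :=
  ∀ j : ℕ, 1 ≤ j → j < m → μ (2 * j) / μ 0 = entry (jacobi a 0 ^ (2 * j)) 0 0

end Freud

end

noncomputable section

namespace Freud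

open Polynomial

section General

variable {K : Type*} [Field K]

/-! ### The action of the Jacobi matrix with zero diagonal -/

/-! Everything passes through the functional `L f = (f(J))_{00}` and the identity `L(P' f) = L(f')`
for all polynomials `f`. On monomials of odd degree this identity is the moment recurrence for `μ_0
(J^j)_{00}`; on even degrees both sides vanish by parity (`momentRecurrence_jacobi_iff`).

Freud's equations give the identity: the strictly upper part `U` of `V = P'(J)` satisfies `UJ - JU =
1`, so `U` acts on the vectors `f(J) e_0` as differentiation (`strictUpper_mul_jacobi`,
`functional_of_solvesFreud`). Conversely, if no `a_n` (`n ≥ 1`) vanishes, testing with products of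
consecutive monic orthogonal polynomials returns Freud's equations (`solvesFreud_of_functional`).

The recurrence determines all moments from the first `m` even ones, so a solution of Freud's
equations has `μ_j = μ_0 (J^j)_{00}`. The Hankel formulas say the same: a Gram factorization
evaluates the determinants of these moments (`hankelDet_jacobi`), and nonzero Hankel determinants
with vanishing odd moments recover the moments (`eq_jacobi_of_givenByHankel`). -/

theorem jacobi_single (a : ℤ → K) (j : ℕ) :
    jacobi a 0 (Finsupp.single j 1) = Finsupp.single (j + 1) (a (j + 1)) +
      (if 1 ≤ j then Finsupp.single (j - 1) (a j) else 0) := by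
  simp [jacobi]

theorem jacobi_apply_zero (a : ℤ → K) (w : ℕ →₀ K) : jacobi a 0 w 0 = a 1 * w 1 := by
  induction w using Finsupp.induction_linear with
  | zero => simp
  | add f g hf hg => simp [hf, hg, mul_add]
  | single j x =>
    rw [← mul_one x, ← smul_eq_mul, ← Finsupp.smul_single, map_smul, jacobi_single]
    rcases j with _ | _ | j <;> simp [mul_comm]

theorem jacobi_apply_succ (a : ℤ → K) (w : ℕ →₀ K) (i : ℕ) :
    jacobi a 0 w (i + 1) = a (i + 1) * w i + a (i + 2) * w (i + 2) := by
  induction w using Finsupp.induction_linear with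
  | zero => simp
  | add f g hf hg => simp only [map_add, Finsupp.add_apply, hf, hg]; ring
  | single j x =>
    rw [← mul_one x, ← smul_eq_mul, ← Finsupp.smul_single, map_smul, jacobi_single]
    rcases j with _ | j
    · by_cases h : i = 0
      · subst h; simp [mul_comm]
      · simp [h]
    · by_cases h : j + 1 = i
      · subst h
        have h1 : j ≠ j + 1 + 1 := by omega
        simp [h1, mul_comm]
      · by_cases h' : j = i + 1
        · subst h'
          simp [mul_comm, add_assoc, one_add_one_eq_two]
        · simp [h, h']

theorem apply_single (T : Module.End K (ℕ →₀ K)) (i j : ℕ) (x : K) :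
    T (Finsupp.single j x) i = x * entry T i j := by
  rw [entry, ← smul_eq_mul x (T _ _), ← Finsupp.smul_apply, ← map_smul, Finsupp.smul_single,
    smul_eq_mul, mul_one]

theorem entry_add (S T : Module.End K (ℕ →₀ K)) (i j : ℕ) :
    entry (S + T) i j = entry S i j + entry T i j := by
  simp [entry]

theorem entry_smul (x : K) (T : Module.End K (ℕ →₀ K)) (i j : ℕ) :
    entry (x • T) i j = x * entry T i j := by
  simp [entry]

theorem entry_sum {ι : Type*} (s : Finset ι) (T : ι → Module.End K (ℕ →₀ K)) (i j : ℕ) :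
    entry (∑ k ∈ s, T k) i j = ∑ k ∈ s, entry (T k) i j := by
  simp [entry, LinearMap.sum_apply, Finsupp.finsetSum_apply]

/-! ### The standard bilinear form -/

/-- The standard symmetric bilinear form `∑ i, x i * y i` on finitely supported sequences. -/
def stdForm : (ℕ →₀ K) →ₗ[K] (ℕ →₀ K) →ₗ[K] K :=
  Finsupp.linearCombination K fun i : ℕ => Finsupp.lapply i

theorem stdForm_single_left (i : ℕ) (x : K) (y : ℕ →₀ K) :
    stdForm (Finsupp.single i x) y = x * y i := by
  simp [stdForm]

theorem stdForm_single_right (i : ℕ) (x : ℕ →₀ K) (y : K) :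
    stdForm x (Finsupp.single i y) = x i * y := by
  induction x using Finsupp.induction_linear with
  | zero => simp
  | add f g hf hg => simp only [map_add, LinearMap.add_apply, Finsupp.add_apply, hf, hg]; ring
  | single j x =>
    rw [stdForm_single_left]
    by_cases h : j = i
    · subst h; simp
    · simp [h, Ne.symm h]

theorem stdForm_eq_sum (x y : ℕ →₀ K) (n : ℕ) (hx : ∀ k, n ≤ k → x k = 0) :
    stdForm x y = ∑ k ∈ Finset.range n, x k * y k := by
  have : x.support ⊆ Finset.range n := by
    intro k hk
    by_contra h
    exact (Finsupp.mem_support_iff.1 hk) (hx k (by simpa using h))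
  simp only [stdForm, Finsupp.linearCombination_apply, Finsupp.sum, LinearMap.sum_apply,
    LinearMap.smul_apply, Finsupp.lapply_apply, smul_eq_mul]
  refine Finset.sum_subset this fun k _ hk => ?_
  simp [Finsupp.notMem_support_iff.1 hk]

theorem stdForm_jacobi (a : ℤ → K) (x y : ℕ →₀ K) :
    stdForm (jacobi a 0 x) y = stdForm x (jacobi a 0 y) := by
  induction x using Finsupp.induction_linear with
  | zero => simp
  | add f g hf hg => simp only [map_add, LinearMap.add_apply, hf, hg]
  | single j x =>
    rw [← mul_one x, ← smul_eq_mul, ← Finsupp.smul_single, map_smul, jacobi_single]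
    simp only [map_smul, LinearMap.smul_apply, map_add, LinearMap.add_apply, stdForm_single_left]
    rcases j with _ | j
    · simp [jacobi_apply_zero]
    · simp only [le_add_iff_nonneg_left, zero_le, if_true, stdForm_single_left,
        jacobi_apply_succ, Nat.add_sub_cancel]
      push_cast
      ring_nf

theorem stdForm_aeval_jacobi (a : ℤ → K) (f : K[X]) (x y : ℕ →₀ K) :
    stdForm (aeval (jacobi a 0) f x) y = stdForm x (aeval (jacobi a 0) f y) := by
  induction f using Polynomial.induction_on' generalizing x y with
  | add p q hp hq => simp only [map_add, LinearMap.add_apply, hp, hq]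
  | monomial n r =>
    induction n generalizing x y with
    | zero => simp [Module.algebraMap_end_apply]
    | succ n ih =>
      rw [← monomial_mul_X, map_mul, aeval_X, Module.End.mul_apply, ih, stdForm_jacobi,
        ← Module.End.mul_apply]
      have := ((Commute.all X (monomial n r)).map (aeval (jacobi a 0))).eq
      rw [aeval_X] at this
      rw [this]

theorem entry_eq_stdForm (T : Module.End K (ℕ →₀ K)) (i j : ℕ) :
    entry T i j = stdForm (Finsupp.single i 1) (T (Finsupp.single j 1)) := by
  simp [entry, stdForm_single_left]

theorem entry_aeval_symm (a : ℤ → K) (f : K[X]) (i j : ℕ) :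
    entry (aeval (jacobi a 0) f) i j = entry (aeval (jacobi a 0) f) j i := by
  rw [entry_eq_stdForm, ← stdForm_aeval_jacobi, stdForm_single_right, mul_one, entry]

theorem entry_aeval_mul (a : ℤ → K) (f g : K[X]) (i j : ℕ) :
    entry (aeval (jacobi a 0) (f * g)) i j =
      stdForm (aeval (jacobi a 0) f (Finsupp.single i 1))
        (aeval (jacobi a 0) g (Finsupp.single j 1)) := by
  rw [entry_eq_stdForm, map_mul, Module.End.mul_apply, stdForm_aeval_jacobi]

theorem entry_aeval_mul_single (a : ℤ → K) (f g : K[X]) (i j n : ℕ) (x : K)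
    (hg : aeval (jacobi a 0) g (Finsupp.single j 1) = Finsupp.single n x) :
    entry (aeval (jacobi a 0) (f * g)) i j =
      aeval (jacobi a 0) f (Finsupp.single i 1) n * x := by
  rw [entry_aeval_mul, hg, stdForm_single_right]

/-! ### Powers of the Jacobi matrix -/

theorem jacobi_pow_apply_of_lt (a : ℤ → K) (k i : ℕ) (h : k < i) :
    (jacobi a 0 ^ k) (Finsupp.single 0 1) i = 0 := by
  induction k generalizing i with
  | zero => simp [h.ne]
  | succ k ih =>
    rw [pow_succ', Module.End.mul_apply]
    obtain ⟨i, rfl⟩ : ∃ i', i = i' + 1 := ⟨i - 1, by omega⟩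
    rw [jacobi_apply_succ, ih i (by omega), ih (i + 2) (by omega)]
    simp

/-- With zero diagonal, each application of `J` shifts the index by exactly one, so parity is
preserved along walks. -/
theorem entry_jacobi_pow_of_odd (a : ℤ → K) (k i j : ℕ) (h : Odd (i + j + k)) :
    entry (jacobi a 0 ^ k) i j = 0 := by
  induction k generalizing i with
  | zero =>
    have : j ≠ i := by rintro rfl; obtain ⟨r, hr⟩ := h; omega
    simp [entry, this]
  | succ k ih =>
    simp only [entry] at ih ⊢
    rw [pow_succ', Module.End.mul_apply]
    rcases i with _ | i
    · rw [jacobi_apply_zero, ih 1 (by convert h using 1; ring), mul_zero]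
    · rw [jacobi_apply_succ, ih i, ih (i + 2), mul_zero, mul_zero, add_zero]
      · convert h using 1; ring
      · obtain ⟨r, hr⟩ := h; exact ⟨r - 1, by omega⟩

/-- The product `a 1 * ⋯ * a n`. -/
def coeffProd (a : ℤ → K) (n : ℕ) : K := ∏ k ∈ Finset.range n, a (k + 1)

theorem coeffProd_succ (a : ℤ → K) (n : ℕ) :
    coeffProd a (n + 1) = coeffProd a n * a (n + 1) := Finset.prod_range_succ _ _

theorem jacobi_pow_apply_self (a : ℤ → K) (k : ℕ) :
    (jacobi a 0 ^ k) (Finsupp.single 0 1) k = coeffProd a k := by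
  induction k with
  | zero => simp [coeffProd]
  | succ k ih =>
    rw [pow_succ', Module.End.mul_apply, jacobi_apply_succ, ih,
      jacobi_pow_apply_of_lt a k (k + 2) (by omega), coeffProd_succ]
    ring

theorem aeval_jacobi_apply_of_natDegree_le (a : ℤ → K) (f : K[X]) (n : ℕ)
    (hf : f.natDegree ≤ n) :
    aeval (jacobi a 0) f (Finsupp.single 0 1) n = f.coeff n * coeffProd a n := by
  rw [aeval_eq_sum_range' (Nat.lt_succ_of_le hf), LinearMap.sum_apply, Finsupp.finsetSum_apply,
    Finset.sum_range_succ, Finset.sum_eq_zero]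
  · simp [jacobi_pow_apply_self]
  · intro k hk
    simp [jacobi_pow_apply_of_lt a k n (Finset.mem_range.1 hk)]

theorem jacobi_pow_single_congr (a a' : ℤ → K) (m : ℕ)
    (h : ∀ n : ℤ, 1 ≤ n → n < m → a' n = a n) (k : ℕ) (hk : k < m) :
    (jacobi a' 0 ^ k) (Finsupp.single 0 1) = (jacobi a 0 ^ k) (Finsupp.single 0 1) := by
  induction k with
  | zero => simp
  | succ k ih =>
    rw [pow_succ', Module.End.mul_apply, pow_succ', Module.End.mul_apply, ih (by omega)]
    -- A weight `a r` meets only a coordinate `i ≥ r - 1`; that coordinate is zero for `i > k`, and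
    -- otherwise `r ≤ k + 1 < m`.
    have key : ∀ (r : ℤ) (i : ℕ), (r = i ∨ r = i + 1) → 1 ≤ r →
        a' r * (jacobi a 0 ^ k) (Finsupp.single 0 1) i =
          a r * (jacobi a 0 ^ k) (Finsupp.single 0 1) i := by
      intro r i hr hr1
      by_cases hi : k < i
      · rw [jacobi_pow_apply_of_lt a k i hi, mul_zero, mul_zero]
      · rw [h r hr1 (by omega)]
    ext i
    rcases i with _ | i
    · rw [jacobi_apply_zero, jacobi_apply_zero, key 1 1 (by simp) le_rfl]
    · rw [jacobi_apply_succ, jacobi_apply_succ, key _ i (by simp) (by omega),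
        key _ (i + 2) (by simp) (by omega)]

theorem entry_jacobi_pow_add (a : ℤ → K) (i j : ℕ) :
    entry (jacobi a 0 ^ (i + j)) 0 0 = stdForm ((jacobi a 0 ^ i) (Finsupp.single 0 1))
      ((jacobi a 0 ^ j) (Finsupp.single 0 1)) := by
  simpa [← pow_add] using entry_aeval_mul a (X ^ i) (X ^ j) 0 0

/-- By symmetry of `J` the entry is the form of `J^j e_0` with itself, and `j` steps from `0` see
only `a 1, …, a j`. -/
theorem entry_jacobi_pow_congr (a a' : ℤ → K) (m : ℕ)
    (h : ∀ n : ℤ, 1 ≤ n → n < m → a' n = a n) (j : ℕ) (hj : j < m) :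
    entry (jacobi a' 0 ^ (2 * j)) 0 0 = entry (jacobi a 0 ^ (2 * j)) 0 0 := by
  rw [two_mul, entry_jacobi_pow_add, entry_jacobi_pow_add, jacobi_pow_single_congr a a' m h j hj]

/-! ### Hankel determinants of the moments of the Jacobi matrix -/

theorem hankelDet_zero (μ : ℕ → K) : hankelDet μ 0 = 1 := by simp [hankelDet]

theorem hankelDet_one (μ : ℕ → K) : hankelDet μ 1 = μ 0 := by simp [hankelDet]

/-- The Hankel matrix is `μ₀` times the Gram matrix of the vectors `J^i e_0`, whose coordinates form
an upper triangular matrix with diagonal `a 1 ⋯ a i`. -/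
theorem hankelDet_jacobi (a : ℤ → K) (μ₀ : K) (n : ℕ) :
    hankelDet (fun j => μ₀ * entry (jacobi a 0 ^ j) 0 0) n =
      μ₀ ^ n * (∏ i ∈ Finset.range n, coeffProd a i) ^ 2 := by
  let M : Matrix (Fin n) (Fin n) K :=
    Matrix.of fun k i => (jacobi a 0 ^ (i : ℕ)) (Finsupp.single 0 1) k
  have hM : (Matrix.of fun i j : Fin n => μ₀ * entry (jacobi a 0 ^ ((i : ℕ) + j)) 0 0) =
      μ₀ • (M.transpose * M) := by
    ext i j
    rw [Matrix.of_apply, entry_jacobi_pow_add, stdForm_eq_sum _ _ n, Matrix.smul_apply,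
      Matrix.mul_apply, Finset.sum_range, smul_eq_mul]
    · rfl
    · intro k hk
      exact jacobi_pow_apply_of_lt a i k (by omega)
  have hdet : M.det = ∏ i ∈ Finset.range n, coeffProd a i := by
    rw [Matrix.det_of_isUpperTriangular, Finset.prod_range]
    · exact Finset.prod_congr rfl fun i _ => jacobi_pow_apply_self a i
    · intro k i hik
      exact jacobi_pow_apply_of_lt a i k hik
  rw [hankelDet, hM, Matrix.det_smul, Matrix.det_mul, Matrix.det_transpose, hdet,
    Fintype.card_fin, sq]

theorem hankelDet_jacobi_succ (a : ℤ → K) (μ₀ : K) (n : ℕ) :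
    hankelDet (fun j => μ₀ * entry (jacobi a 0 ^ j) 0 0) (n + 1) =
      μ₀ * coeffProd a n ^ 2 * hankelDet (fun j => μ₀ * entry (jacobi a 0 ^ j) 0 0) n := by
  rw [hankelDet_jacobi, hankelDet_jacobi, Finset.prod_range_succ]
  ring

theorem hankelDet_jacobi_mul (a : ℤ → K) (μ₀ : K) (n : ℕ) :
    hankelDet (fun j => μ₀ * entry (jacobi a 0 ^ j) 0 0) n *
        hankelDet (fun j => μ₀ * entry (jacobi a 0 ^ j) 0 0) (n + 2) =
      a (n + 1) ^ 2 * hankelDet (fun j => μ₀ * entry (jacobi a 0 ^ j) 0 0) (n + 1) ^ 2 := by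
  rw [hankelDet_jacobi_succ a μ₀ (n + 1), hankelDet_jacobi_succ a μ₀ n, coeffProd_succ]
  ring

/-- The two matrices differ only in the bottom right corner, whose cofactor is `H_n`. -/
theorem hankelDet_succ_sub (μ ν : ℕ → K) (n : ℕ) (h : ∀ j, j < 2 * n → μ j = ν j) :
    hankelDet μ (n + 1) - hankelDet ν (n + 1) = (μ (2 * n) - ν (2 * n)) * hankelDet μ n := by
  have minor : ∀ j : Fin (n + 1),
      ((Matrix.of fun i j : Fin (n + 1) => ν (i + j)).submatrix
        (Fin.last n).succAbove j.succAbove) =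
      (Matrix.of fun i j : Fin (n + 1) => μ (i + j)).submatrix
        (Fin.last n).succAbove j.succAbove := by
    intro j
    ext i k
    simp only [Matrix.submatrix_apply, Matrix.of_apply, Fin.succAbove_last, Fin.val_castSucc]
    refine (h _ ?_).symm
    omega
  have last : (Matrix.of fun i j : Fin (n + 1) => μ (i + j)).submatrix
        (Fin.last n).succAbove (Fin.last n).succAbove =
      Matrix.of fun i j : Fin n => μ (i + j) := by
    ext i k
    simp [Fin.succAbove_last]
  rw [hankelDet, hankelDet, Matrix.det_succ_row _ (Fin.last n),
    Matrix.det_succ_row (Matrix.of fun i j : Fin (n + 1) => ν (i + j)) (Fin.last n),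
    ← Finset.sum_sub_distrib, Fin.sum_univ_castSucc, Finset.sum_eq_zero]
  · rw [minor, last, hankelDet]
    simp [← two_mul, sub_mul]
  · intro j _
    rw [minor]
    simp only [Matrix.of_apply, Fin.val_last, Fin.val_castSucc]
    rw [h (n + j) (by omega), sub_self]

theorem hankelDetTilde_eq_zero [CharZero K] (μ : ℕ → K) (hμ : ∀ j, μ (2 * j + 1) = 0) (n : ℕ) :
    hankelDetTilde μ n = 0 := by
  rcases n with _ | n
  · simp [hankelDetTilde]
  let col : Fin (n + 1) → ℕ := fun j => if (j : ℕ) + 1 = n + 1 then n + 1 else j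
  let A : Matrix (Fin (n + 1)) (Fin (n + 1)) K := Matrix.of fun i j => μ (i + col j)
  -- Entries with odd index sum vanish, so these signs change nothing. Their total effect on the
  -- determinant is `-1`, since only the last column is shifted by one; hence `det A = -det A`.
  have hA : A = Matrix.of fun i j : Fin (n + 1) => (-1) ^ (i : ℕ) *
      (Matrix.of fun i j => (-1) ^ col j * A i j : Matrix (Fin (n + 1)) (Fin (n + 1)) K) i j := by
    ext i j
    simp only [Matrix.of_apply, A]
    rw [← mul_assoc, ← pow_add]
    rcases Nat.even_or_odd' ((i : ℕ) + col j) with ⟨k, hk | hk⟩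
    · rw [hk]; simp
    · rw [hk, hμ]; simp
  have h1 := congrArg Matrix.det hA
  rw [Matrix.det_mul_column, Matrix.det_mul_row, ← mul_assoc, ← Finset.prod_mul_distrib,
    Fin.prod_univ_castSucc, Finset.prod_eq_one] at h1
  · have h2 : (-1 : K) ^ (Fin.last n : ℕ) * (-1) ^ col (Fin.last n) = -1 := by
      simp [col, pow_succ, ← mul_pow]
    rw [one_mul, h2, neg_one_mul] at h1
    have : A.det = 0 := self_eq_neg.1 h1
    simpa [hankelDetTilde, A, col] using this
  · intro j _
    have : (j : ℕ) ≠ n := j.2.ne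
    simp [col, this, ← mul_pow]

/-! ### The moment functional and the recurrence of the moments -/

theorem derivative_evenPoly (m : ℕ) (c : ℕ → K) :
    derivative (evenPoly m c) = ∑ i ∈ Finset.range m,
      C (((2 * (m - i) : ℕ) : K) * c i) * X ^ (2 * (m - i) - 1) := by
  rw [evenPoly, derivative_sum, Finset.sum_range_succ]
  simp only [derivative_C_mul, derivative_X_pow]
  simp only [Nat.sub_self, mul_zero, Nat.cast_zero, map_zero, zero_mul, add_zero]
  refine Finset.sum_congr rfl fun i _ => ?_
  rw [C_mul]
  ring

theorem entry_aeval_derivative_evenPoly (m : ℕ) (c : ℕ → K) (a : ℤ → K) (k i j : ℕ) :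
    entry (aeval (jacobi a 0) (derivative (evenPoly m c) * X ^ k)) i j =
      ∑ r ∈ Finset.range m, ((2 * (m - r) : ℕ) : K) * c r *
        entry (jacobi a 0 ^ (2 * (m - r) - 1 + k)) i j := by
  rw [derivative_evenPoly, Finset.sum_mul, map_sum, entry_sum]
  refine Finset.sum_congr rfl fun r _ => ?_
  rw [mul_assoc, ← pow_add, C_mul', map_smul, map_pow, aeval_X, entry_smul]

theorem entry_aeval_derivative_evenPoly_diag (m : ℕ) (c : ℕ → K) (a : ℤ → K) (i : ℕ) :
    entry (aeval (jacobi a 0) (derivative (evenPoly m c))) i i = 0 := by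
  rw [← mul_one (derivative (evenPoly m c)), ← pow_zero X, entry_aeval_derivative_evenPoly]
  refine Finset.sum_eq_zero fun r hr => ?_
  have := Finset.mem_range.1 hr
  rw [entry_jacobi_pow_of_odd, mul_zero]
  exact ⟨i + (m - r) - 1, by omega⟩

theorem momentRecurrence_jacobi_iff (m : ℕ) (c : ℕ → K) (a : ℤ → K) (μ₀ : K) (h₀ : μ₀ ≠ 0) :
    MomentRecurrence m c (fun j => μ₀ * entry (jacobi a 0 ^ j) 0 0) ↔
      ∀ f : K[X], entry (aeval (jacobi a 0) (derivative (evenPoly m c) * f)) 0 0 =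
        entry (aeval (jacobi a 0) (derivative f)) 0 0 := by
  have hodd : ∀ n, entry (aeval (jacobi a 0)
      (derivative (evenPoly m c) * X ^ (2 * n + 1))) 0 0 = ∑ i ∈ Finset.range m,
        ((2 * (m - i) : ℕ) : K) * c i * entry (jacobi a 0 ^ (2 * n + 2 * (m - i))) 0 0 := by
    intro n
    rw [entry_aeval_derivative_evenPoly]
    refine Finset.sum_congr rfl fun r hr => ?_
    have := Finset.mem_range.1 hr
    congr 3
    omega
  have hder : ∀ k : ℕ, entry (aeval (jacobi a 0) (derivative (X ^ k : K[X]))) 0 0 =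
      (k : K) * entry (jacobi a 0 ^ (k - 1)) 0 0 := by
    intro k
    rw [derivative_X_pow, C_mul', map_smul, map_pow, aeval_X, entry_smul]
  constructor
  · rintro ⟨-, h⟩ f
    induction f using Polynomial.induction_on' with
    | add p q hp hq => simp only [mul_add, map_add, entry_add, hp, hq]
    | monomial k x =>
      rw [← C_mul_X_pow_eq_monomial, C_mul', mul_smul_comm, map_smul, derivative_smul, map_smul,
        entry_smul, entry_smul]
      congr 1
      rcases Nat.even_or_odd' k with ⟨n, rfl | rfl⟩
      · rw [hder, entry_aeval_derivative_evenPoly, Finset.sum_eq_zero]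
        · rcases n with _ | n
          · simp
          · rw [entry_jacobi_pow_of_odd, mul_zero]
            exact ⟨n, by omega⟩
        · intro r hr
          have := Finset.mem_range.1 hr
          rw [entry_jacobi_pow_of_odd, mul_zero]
          exact ⟨n + (m - r) - 1, by omega⟩
      · rw [hodd, hder]
        apply mul_left_cancel₀ h₀
        have := h n
        simp only [mul_left_comm _ μ₀, ← Finset.mul_sum] at this
        simpa using this
  · intro h
    refine ⟨fun j => ?_, fun n => ?_⟩
    · beta_reduce
      rw [entry_jacobi_pow_of_odd, mul_zero]
      exact ⟨j, by omega⟩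
    · have := h (X ^ (2 * n + 1))
      rw [hodd, hder] at this
      simp only [mul_left_comm _ μ₀, ← Finset.mul_sum, this]
      simp

/-- The monic polynomials `p` with `p (n+2) = X * p (n+1) - a (n+1) ^ 2 * p n`. -/
def monicPoly (a : ℤ → K) : ℕ → K[X]
  | 0 => 1
  | 1 => X
  | n + 2 => X * monicPoly a (n + 1) - C (a (n + 1) ^ 2) * monicPoly a n

theorem monicPoly_natDegree_le_and_coeff (a : ℤ → K) (n : ℕ) :
    (monicPoly a n).natDegree ≤ n ∧ (monicPoly a n).coeff n = 1 := by
  induction n using Nat.twoStepInduction with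
  | zero => simp [monicPoly]
  | one => simp [monicPoly]
  | more n ih1 ih2 =>
    have hlt : (monicPoly a n).coeff (n + 2) = 0 :=
      coeff_eq_zero_of_natDegree_lt (by have := ih1.1; omega)
    refine ⟨?_, ?_⟩
    · rw [monicPoly]
      refine (natDegree_sub_le_of_le (m := n + 2) (n := n + 2) ?_ ?_).trans (by simp)
      · have := natDegree_mul_le_of_le (natDegree_X_le (R := K)) ih2.1
        omega
      · exact (natDegree_C_mul_le _ _).trans (by have := ih1.1; omega)
    · rw [monicPoly, coeff_sub, coeff_C_mul, hlt, coeff_X_mul, ih2.2]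
      simp

/-- The recursion of the monic polynomials cancels the backward step of `J`. This is their
orthogonality with respect to `L`. -/
theorem aeval_monicPoly (a : ℤ → K) (n : ℕ) :
    aeval (jacobi a 0) (monicPoly a n) (Finsupp.single 0 1) =
      Finsupp.single n (coeffProd a n) := by
  induction n using Nat.twoStepInduction with
  | zero => simp [monicPoly, coeffProd]
  | one => simp [monicPoly, coeffProd, jacobi_single]
  | more n ih1 ih2 =>
    rw [monicPoly, map_sub, C_mul', map_smul, map_mul, aeval_X, LinearMap.sub_apply,
      LinearMap.smul_apply, Module.End.mul_apply, ih1, ih2,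
      ← mul_one (coeffProd a (n + 1)), ← smul_eq_mul, ← Finsupp.smul_single, map_smul,
      jacobi_single]
    simp only [coeffProd_succ, le_add_iff_nonneg_left, zero_le, if_true, smul_add,
      Finsupp.smul_single, smul_eq_mul, Nat.add_sub_cancel, Nat.cast_add, Nat.cast_one]
    rw [add_sub_assoc, ← Finsupp.single_sub]
    have : coeffProd a n * a (n + 1) * a (n + 1) - a (n + 1) ^ 2 * coeffProd a n = 0 := by ring
    rw [this, Finsupp.single_zero, add_zero]

/-! ### Freud's equations and the moment functional -/

theorem solvesFreud_of_functional (P : K[X]) (a : ℤ → K) (ha : ∀ n, coeffProd a n ≠ 0)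
    (h : ∀ f : K[X], entry (aeval (jacobi a 0) (derivative P * f)) 0 0 =
      entry (aeval (jacobi a 0) (derivative f)) 0 0) : SolvesFreud P a := by
  intro n hn
  obtain ⟨n, rfl⟩ : ∃ k, n = k + 1 := ⟨n - 1, by omega⟩
  have hn0 := (monicPoly_natDegree_le_and_coeff a n).1
  have hn1 := monicPoly_natDegree_le_and_coeff a (n + 1)
  -- With `p_k = monicPoly a k`, the left side isolates the entry `(n+1, n)` of `P'(J)`. On the
  -- right `p_n' p_{n+1}` contributes zero by degree, and `p_{n+1}' p_n` only its leading
  -- coefficient `n + 1`.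
  have key := h (monicPoly a n * monicPoly a (n + 1))
  have e1 : entry (aeval (jacobi a 0)
      (derivative P * (monicPoly a n * monicPoly a (n + 1)))) 0 0 =
      coeffProd a n * entry (aeval (jacobi a 0) (derivative P)) (n + 1) n *
        coeffProd a (n + 1) := by
    rw [← mul_assoc, entry_aeval_mul_single a _ _ 0 0 _ _ (aeval_monicPoly a (n + 1)), map_mul,
      Module.End.mul_apply, aeval_monicPoly, apply_single]
  have e2 : entry (aeval (jacobi a 0)
      (derivative (monicPoly a n) * monicPoly a (n + 1))) 0 0 = 0 := by
    have hd : (derivative (monicPoly a n)).natDegree ≤ n :=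
      (natDegree_derivative_le _).trans (by omega)
    rw [entry_aeval_mul_single a _ _ 0 0 _ _ (aeval_monicPoly a (n + 1)),
      aeval_jacobi_apply_of_natDegree_le _ _ _ (by omega),
      coeff_eq_zero_of_natDegree_lt (by omega), zero_mul, zero_mul]
  have e3 : entry (aeval (jacobi a 0)
      (derivative (monicPoly a (n + 1)) * monicPoly a n)) 0 0 =
      (n + 1) * coeffProd a n * coeffProd a n := by
    have hd : (derivative (monicPoly a (n + 1))).natDegree ≤ n :=
      (natDegree_derivative_le _).trans (by omega)
    rw [entry_aeval_mul_single a _ _ 0 0 _ _ (aeval_monicPoly a n),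
      aeval_jacobi_apply_of_natDegree_le _ _ _ hd, coeff_derivative, hn1.2, one_mul]
  rw [derivative_mul, map_add, entry_add, e1, e2, mul_comm (monicPoly a n), e3, zero_add,
    coeffProd_succ] at key
  apply mul_left_cancel₀ (ha n)
  apply mul_left_cancel₀ (ha n)
  rw [freudF, Nat.add_sub_cancel]
  push_cast
  linear_combination key

/-- The strictly upper triangular part of an infinite matrix. -/
def strictUpper (T : Module.End K (ℕ →₀ K)) : Module.End K (ℕ →₀ K) :=
  Finsupp.linearCombination K fun j : ℕ => (T (Finsupp.single j 1)).filter (· < j)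

theorem strictUpper_single_apply (T : Module.End K (ℕ →₀ K)) (j i : ℕ) (x : K) :
    strictUpper T (Finsupp.single j x) i = if i < j then x * entry T i j else 0 := by
  simp [strictUpper, Finsupp.filter_apply, entry]

/-- Since `J` is tridiagonal, `[U, J]` vanishes below the diagonal. Above it, it agrees with `[V, J]
= 0`, because `V` has zero diagonal. On the diagonal it is a difference of consecutive Freud
equations, `(j + 1) - j = 1`. -/
theorem strictUpper_mul_jacobi (P : K[X]) (a : ℤ → K) (hP : SolvesFreud P a)
    (hdiag : ∀ i, entry (aeval (jacobi a 0) (derivative P)) i i = 0) :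
    strictUpper (aeval (jacobi a 0) (derivative P)) * jacobi a 0 =
      jacobi a 0 * strictUpper (aeval (jacobi a 0) (derivative P)) + 1 := by
  set V := aeval (jacobi a 0) (derivative P) with hV
  have hsymm : ∀ i j, entry V i j = entry V j i := entry_aeval_symm a _
  have hfreud : ∀ j : ℕ, a (j + 1) * entry V j (j + 1) = j + 1 := by
    intro j
    have := hP (j + 1) (by omega)
    rw [freudF, Nat.add_sub_cancel] at this
    rw [hsymm]
    exact_mod_cast this
  have hcomm : V * jacobi a 0 = jacobi a 0 * V := by
    have := (Commute.all (derivative P) X).map (aeval (jacobi a 0))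
    rwa [aeval_X] at this
  have hc : ∀ i j, (V * jacobi a 0) (Finsupp.single j 1) i =
      (jacobi a 0 * V) (Finsupp.single j 1) i := fun i j => by rw [hcomm]
  refine Finsupp.lhom_ext' fun j => LinearMap.ext_ring (Finsupp.ext fun i => ?_)
  have hc := hc i j
  simp only [LinearMap.comp_apply, Finsupp.lsingle_apply, Module.End.mul_apply,
    LinearMap.add_apply, Finsupp.add_apply, Module.End.one_apply, jacobi_single] at hc ⊢
  rcases j with _ | j <;> rcases i with _ | i
  · have := hfreud 0
    simp at this
    simp [jacobi_apply_zero, strictUpper_single_apply, this]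
  · simp [jacobi_apply_succ, strictUpper_single_apply]
  · simp only [le_add_iff_nonneg_left, zero_le, if_true, map_add, Finsupp.add_apply,
      jacobi_apply_zero, strictUpper_single_apply, apply_single V, Nat.add_sub_cancel] at hc ⊢
    rcases j with _ | j
    · simp [hdiag] at hc ⊢
      exact hc
    · simp at hc ⊢
      exact hc
  · simp only [le_add_iff_nonneg_left, zero_le, if_true, map_add, Finsupp.add_apply,
      jacobi_apply_succ, strictUpper_single_apply, apply_single V, Nat.add_sub_cancel, one_mul,
      Finsupp.single_apply, Nat.add_right_cancel_iff] at hc ⊢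
    rcases lt_trichotomy i j with h | rfl | h
    -- Next to the diagonal, `[V, J]` also involves diagonal entries of `V`, which `U` discards;
    -- `hdiag` removes them.
    · rcases (Nat.succ_le_of_lt h).eq_or_lt with h' | h'
      · obtain rfl : j = i + 1 := h'.symm
        simp [hdiag] at hc ⊢
        linear_combination hc
      · have h1 : i + 1 < j + 1 + 1 := by omega
        have h2 : i + 1 < j := by omega
        have h3 : i < j + 1 := by omega
        have h4 : i + 2 < j + 1 := by omega
        have h5 : j ≠ i := by omega
        simp only [h1, h2, h3, h4, h5, if_true, if_false, add_zero]
        exact hc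
    · have h1 := hfreud i
      have h2 := hfreud (i + 1)
      push_cast at h2
      simp
      linear_combination h2 - h1
    · have h1 : ¬ i + 1 < j + 1 + 1 := by omega
      have h2 : ¬ i + 1 < j := by omega
      have h3 : ¬ i < j + 1 := by omega
      have h4 : ¬ i + 2 < j + 1 := by omega
      have h5 : j ≠ i := by omega
      simp [h1, h2, h3, h4, h5]

theorem functional_of_solvesFreud (P : K[X]) (a : ℤ → K) (hP : SolvesFreud P a)
    (hdiag : ∀ i, entry (aeval (jacobi a 0) (derivative P)) i i = 0) (f : K[X]) :
    entry (aeval (jacobi a 0) (derivative P * f)) 0 0 =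
      entry (aeval (jacobi a 0) (derivative f)) 0 0 := by
  have hmul := strictUpper_mul_jacobi P a hP hdiag
  set V := aeval (jacobi a 0) (derivative P) with hV
  have hzero : strictUpper V (Finsupp.single 0 1) = 0 := by
    ext i
    rw [strictUpper_single_apply]
    simp
  -- `U` kills `e_0` and satisfies the Weyl relation with `J`, like `d/dx` acting on the constant
  -- `1`.
  have hder : strictUpper V (aeval (jacobi a 0) f (Finsupp.single 0 1)) =
      aeval (jacobi a 0) (derivative f) (Finsupp.single 0 1) := by
    induction f using Polynomial.induction_on' with
    | add p q hp hq => simp only [map_add, LinearMap.add_apply, hp, hq]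
    | monomial n r =>
      rw [← C_mul_X_pow_eq_monomial, C_mul', derivative_smul, map_smul, map_smul,
        LinearMap.smul_apply, LinearMap.smul_apply, map_smul]
      congr 1
      induction n with
      | zero => simp [hzero]
      | succ n ih =>
        rw [pow_succ', derivative_mul, derivative_X, one_mul, map_mul, aeval_X,
          Module.End.mul_apply, ← Module.End.mul_apply, hmul, LinearMap.add_apply,
          Module.End.mul_apply, ih, map_add, map_mul, aeval_X, LinearMap.add_apply,
          Module.End.mul_apply, Module.End.one_apply, add_comm]
  -- Row `0` of `U` is all of row `0` of `V`, as `V_{00} = 0`.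
  have hrow : ∀ w, strictUpper V w 0 = stdForm (V (Finsupp.single 0 1)) w := by
    intro w
    induction w using Finsupp.induction_linear with
    | zero => simp
    | add f g hf hg => simp only [map_add, Finsupp.add_apply, hf, hg]
    | single j x =>
      rw [strictUpper_single_apply, stdForm_single_right, mul_comm (V _ _)]
      change _ = x * entry V j 0
      rw [hV, entry_aeval_symm a _ j 0, ← hV]
      rcases j with _ | j
      · simp [hdiag]
      · simp
  rw [entry_aeval_mul, ← hV, ← hrow, hder, entry]

/-! ### Existence and uniqueness of the moments -/

theorem two_mul_ne_zero_of_ne_zero [CharZero K] {m : ℕ} (hm : 1 ≤ m) {x : K} (hx : x ≠ 0) :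
    ((2 * m : ℕ) : K) * x ≠ 0 :=
  mul_ne_zero (Nat.cast_ne_zero.2 (by omega)) hx

theorem moments_unique [CharZero K] {m : ℕ} (hm : 1 ≤ m) {c : ℕ → K} (hc : c 0 ≠ 0)
    {μ ν : ℕ → K} (hμ : MomentRecurrence m c μ) (hν : MomentRecurrence m c ν)
    (h : ∀ j, j < m → μ (2 * j) = ν (2 * j)) : μ = ν := by
  have key : ∀ k, μ (2 * k) = ν (2 * k) := by
    intro k
    induction k using Nat.strong_induction_on with
    | _ k ih =>
      rcases lt_or_ge k m with hk | hk
      · exact h k hk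
      · obtain ⟨n, rfl⟩ := Nat.exists_eq_add_of_le' hk
        obtain ⟨m, rfl⟩ : ∃ m', m = m' + 1 := ⟨m - 1, by omega⟩
        have h1 := hμ.2 n
        have h2 := hν.2 n
        -- The term `i = 0` carries the highest moment `μ_{2n+2m}`, with coefficient `2m c_0 ≠ 0`.
        rw [Finset.sum_range_succ'] at h1 h2
        have hs : ∑ i ∈ Finset.range m, ((2 * (m + 1 - (i + 1)) : ℕ) : K) * c (i + 1) *
              μ (2 * n + 2 * (m + 1 - (i + 1))) =
            ∑ i ∈ Finset.range m, ((2 * (m + 1 - (i + 1)) : ℕ) : K) * c (i + 1) *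
              ν (2 * n + 2 * (m + 1 - (i + 1))) := by
          refine Finset.sum_congr rfl fun i _ => ?_
          rw [← mul_add 2 n, ih _ (by omega)]
        rw [hs, ih n (by omega), ← h2] at h1
        have h3 := add_left_cancel h1
        rw [Nat.sub_zero, ← mul_add] at h3
        exact mul_left_cancel₀ (two_mul_ne_zero_of_ne_zero hm hc) h3
  funext j
  rcases Nat.even_or_odd' j with ⟨k, rfl | rfl⟩
  · exact key k
  · rw [hμ.1, hν.1]

/-- The even moments with initial values `init 0, …, init m`, given by the recurrence of
the potential of degree `2 (m + 1)`. -/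
def evenMoment (m : ℕ) (c : ℕ → K) (init : ℕ → K) (k : ℕ) : K :=
  if h : k ≤ m then init k else
    ((2 * (k - (m + 1) : ℕ) + 1) * evenMoment m c init (k - (m + 1)) -
      ∑ i ∈ Finset.range m, ((2 * (m - i) : ℕ) : K) * c (i + 1) *
        evenMoment m c init (k - (i + 1))) / (((2 * (m + 1) : ℕ) : K) * c 0)
termination_by k

theorem exists_moments [CharZero K] {m : ℕ} (hm : 1 ≤ m) {c : ℕ → K} (hc : c 0 ≠ 0)
    (init : ℕ → K) :
    ∃ μ, MomentRecurrence m c μ ∧ ∀ j, j < m → μ (2 * j) = init j := by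
  obtain ⟨m, rfl⟩ : ∃ m', m = m' + 1 := ⟨m - 1, by omega⟩
  let μ : ℕ → K := fun j => if j % 2 = 0 then evenMoment m c init (j / 2) else 0
  have heven : ∀ k, μ (2 * k) = evenMoment m c init k := fun k => by simp [μ]
  refine ⟨μ, ⟨fun j => ?_, fun n => ?_⟩, fun j hj => ?_⟩
  · simp [μ, Nat.add_mod]
  · rw [Finset.sum_range_succ']
    simp only [← mul_add 2 n, heven, Nat.sub_zero]
    rw [evenMoment.eq_def m c init (n + (m + 1)), dif_neg (by omega),
      mul_div_cancel₀ _ (two_mul_ne_zero_of_ne_zero hm hc), Nat.add_sub_cancel]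
    have hs : ∑ i ∈ Finset.range m, ((2 * (m + 1 - (i + 1)) : ℕ) : K) * c (i + 1) *
          evenMoment m c init (n + (m + 1 - (i + 1))) =
        ∑ i ∈ Finset.range m, ((2 * (m - i) : ℕ) : K) * c (i + 1) *
          evenMoment m c init (n + (m + 1) - (i + 1)) := by
      refine Finset.sum_congr rfl fun i hi => ?_
      have := Finset.mem_range.1 hi
      rw [Nat.add_sub_add_right]
      congr 2
      omega
    rw [hs]
    ring
  · rw [heven, evenMoment, dif_pos (by omega)]

theorem initialMoments_iff {m : ℕ} {a : ℤ → K} {μ : ℕ → K} (h₀ : μ 0 ≠ 0) :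
    InitialMoments m a μ ↔
      ∀ j, j < m → μ (2 * j) = μ 0 * entry (jacobi a 0 ^ (2 * j)) 0 0 := by
  constructor
  · intro h j hj
    rcases j with _ | j
    · simp [entry]
    · rw [← h (j + 1) (by omega) hj, mul_div_cancel₀ _ h₀]
  · intro h j _ hj
    rw [h j hj, mul_div_cancel_left₀ _ h₀]

theorem existsUnique_moments [CharZero K] {m : ℕ} (hm : 1 ≤ m) {c : ℕ → K} (hc : c 0 ≠ 0)
    (a : ℤ → K) (μ₀ : K) (h₀ : μ₀ ≠ 0) :
    ∃! μ : ℕ → K, μ 0 = μ₀ ∧ MomentRecurrence m c μ ∧ InitialMoments m a μ := by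
  obtain ⟨μ, hrec, hinit⟩ :=
    exists_moments hm hc fun j => μ₀ * entry (jacobi a 0 ^ (2 * j)) 0 0
  have hμ0 : μ 0 = μ₀ := by simpa [entry] using hinit 0 hm
  refine ⟨μ, ⟨hμ0, hrec, (initialMoments_iff (hμ0 ▸ h₀)).2 (hμ0 ▸ hinit)⟩, ?_⟩
  rintro ν ⟨rfl, hν, hνi⟩
  refine moments_unique hm hc hν hrec fun j hj => ?_
  rw [(initialMoments_iff h₀).1 hνi j hj, hinit j hj]

/-! ### Solutions of Freud's equations and Hankel determinants -/

theorem coeffProd_ne_zero {a : ℤ → K} (ha : ∀ n : ℕ, a (n + 1) ≠ 0) (n : ℕ) :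
    coeffProd a n ≠ 0 :=
  Finset.prod_ne_zero_iff.2 fun k _ => ha k

theorem givenByHankel_jacobi [CharZero K] (a : ℤ → K) (ha : ∀ n : ℕ, a (n + 1) ≠ 0) (μ₀ : K)
    (h₀ : μ₀ ≠ 0) : GivenByHankel (fun j => μ₀ * entry (jacobi a 0 ^ j) 0 0) a 0 := by
  have hne : ∀ n, hankelDet (fun j => μ₀ * entry (jacobi a 0 ^ j) 0 0) n ≠ 0 := by
    intro n
    rw [hankelDet_jacobi]
    exact mul_ne_zero (pow_ne_zero _ h₀)
      (pow_ne_zero _ (Finset.prod_ne_zero_iff.2 fun i _ => coeffProd_ne_zero ha i))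
  refine ⟨hne, fun n hn => ?_, fun n => ?_⟩
  · obtain ⟨n, rfl⟩ : ∃ k, n = k + 1 := ⟨n - 1, by omega⟩
    rw [Nat.add_sub_cancel, eq_div_iff (pow_ne_zero _ (hne _)), hankelDet_jacobi_mul]
    push_cast
    rfl
  · have hodd : ∀ j, μ₀ * entry (jacobi a 0 ^ (2 * j + 1)) 0 0 = 0 := fun j => by
      rw [entry_jacobi_pow_of_odd _ _ _ _ ⟨j, by omega⟩, mul_zero]
    rw [hankelDetTilde_eq_zero _ hodd, hankelDetTilde_eq_zero _ hodd]
    simp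

/-- Both Hankel sequences satisfy `H_n H_{n+2} = a_{n+1}^2 H_{n+1}^2` with the same `H_0`, `H_1`, so
they coincide. Each `H_{n+1}` then fixes `μ_{2n}`, on which it depends affinely with slope `H_n ≠
0`. -/
theorem eq_jacobi_of_givenByHankel {μ : ℕ → K} {a : ℤ → K} (hodd : ∀ j, μ (2 * j + 1) = 0)
    (h : GivenByHankel μ a 0) : μ = fun j => μ 0 * entry (jacobi a 0 ^ j) 0 0 := by
  obtain ⟨hne, hsq, -⟩ := h
  have hdet : ∀ n, hankelDet μ n = hankelDet (fun j => μ 0 * entry (jacobi a 0 ^ j) 0 0) n := by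
    intro n
    induction n using Nat.twoStepInduction with
    | zero => rw [hankelDet_zero, hankelDet_zero]
    | one => simp [hankelDet_one, entry]
    | more n ih1 ih2 =>
      have h1 := hsq (n + 1) (by omega)
      rw [Nat.add_sub_cancel, eq_div_iff (pow_ne_zero _ (hne _))] at h1
      have h2 := hankelDet_jacobi_mul a (μ 0) n
      rw [← ih1, ← ih2] at h2
      apply mul_left_cancel₀ (hne n)
      rw [h2, ← h1]
      push_cast
      rfl
  funext j
  induction j using Nat.strong_induction_on with
  | _ j ih =>
    rcases Nat.even_or_odd' j with ⟨n, rfl | rfl⟩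
    · have hs := hankelDet_succ_sub μ _ n ih
      rw [← hdet, sub_self] at hs
      exact sub_eq_zero.1 ((mul_eq_zero.1 hs.symm).resolve_right (hne n))
    · rw [hodd, entry_jacobi_pow_of_odd _ _ _ _ ⟨n, by omega⟩, mul_zero]

theorem solvesFreud_iff_givenByHankel [CharZero K] {m : ℕ} (hm : 1 ≤ m) {c : ℕ → K}
    (hc : c 0 ≠ 0) {a : ℤ → K} {μ : ℕ → K} (h₀ : μ 0 ≠ 0) (hrec : MomentRecurrence m c μ)
    (hinit : InitialMoments m a μ) :
    SolvesFreud (evenPoly m c) a ↔ GivenByHankel μ a 0 := by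
  constructor
  · intro hF
    -- `a_{n+1}` divides the left side of a Freud equation whose right side `n + 1` is nonzero in
    -- characteristic zero.
    have ha : ∀ n : ℕ, a (n + 1) ≠ 0 := by
      intro n h
      have := hF (n + 1) (by omega)
      rw [freudF] at this
      push_cast at this
      rw [h, zero_mul] at this
      exact Nat.cast_add_one_ne_zero n this.symm
    have hν := (momentRecurrence_jacobi_iff m c a (μ 0) h₀).2
      (functional_of_solvesFreud _ a hF (entry_aeval_derivative_evenPoly_diag m c a))
    rw [moments_unique hm hc hrec hν ((initialMoments_iff h₀).1 hinit)]
    exact givenByHankel_jacobi a ha (μ 0) h₀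
  · intro hG
    have ha : ∀ n : ℕ, a (n + 1) ≠ 0 := by
      intro n h
      have h1 := hG.2.1 (n + 1) (by omega)
      push_cast at h1
      rw [h, zero_pow two_ne_zero] at h1
      exact div_ne_zero (mul_ne_zero (hG.1 _) (hG.1 _)) (pow_ne_zero _ (hG.1 _)) h1.symm
    rw [eq_jacobi_of_givenByHankel hrec.1 hG] at hrec
    exact solvesFreud_of_functional _ a (coeffProd_ne_zero ha)
      ((momentRecurrence_jacobi_iff m c a (μ 0) h₀).1 hrec)

end General

end Freud

end

theorem theorem2 {K : Type*} [Field K] [CharZero K] (m : ℕ) (hm : 1 ≤ m)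
    (c : ℕ → K) (hc : c 0 ≠ 0)
    (a : ℤ → K) (ha : ∀ n : ℤ, -(m : ℤ) + 1 ≤ n → n ≤ 0 → a n = 0) :
    -- the moments exist and are determined by `μ 0` and the initial data
    (∀ μ₀ : K, μ₀ ≠ 0 → ∃! μ : ℕ → K,
      μ 0 = μ₀ ∧ Freud.MomentRecurrence m c μ ∧ Freud.InitialMoments m a μ) ∧
    -- only `a 1, …, a (m-1)` enter the initial moments
    (∀ a' : ℤ → K, (∀ n : ℤ, 1 ≤ n → n < m → a' n = a n) →
      ∀ j : ℕ, j < m → Freud.entry (Freud.jacobi a' 0 ^ (2 * j)) 0 0 =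
        Freud.entry (Freud.jacobi a 0 ^ (2 * j)) 0 0) ∧
    -- the solution of Freud's equations is the one given by the determinants of these moments
    (∀ μ : ℕ → K, μ 0 ≠ 0 → Freud.MomentRecurrence m c μ → Freud.InitialMoments m a μ →
      (Freud.SolvesFreud (Freud.evenPoly m c) a ↔ Freud.GivenByHankel μ a 0)) := by
  exact ⟨fun μ₀ h₀ => Freud.existsUnique_moments hm hc a μ₀ h₀,
    fun a' h j hj => Freud.entry_jacobi_pow_congr a a' m h j hj,
    fun _ h₀ hrec hinit => Freud.solvesFreud_iff_givenByHankel hm hc h₀ hrec hinit⟩
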